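/- Let $\mathbb K$ be a field of characteristic $0$. A simple hypergraph over a finite set $V$ is a set $h$ of non-empty subsets (edges) of $V$; $\mathrm{SHG}[V]$ is the $\mathbb K$-vector space with basis the simple hypergraphs over $V$. For $V=V_1\sqcup V_2$ put $\mu_{V_1,V_2}(h_1\otimes h_2)=h_1\sqcup h_2$ and $\Delta_{V_1,V_2}(h)=h|_{V_1}\otimes h/_{V_1}$, where $h|_{V_1}=\{e\in h: e\subseteq V_1\}$ and $h/_{V_1}=\{e\setminus V_1: e\in h,\ e\not\subseteq V_1\}$; $\mu_{V_1,\dots,V_n}$ and $\Delta_{V_1,\dots,V_n}$ are their iterates. A character $\zeta$ of $\mathrm{SHG}$ is a family of linear forms $\zeta_V:\mathrm{SHG}[V]\to\mathbb K$ with $\zeta(x\cdot y)=\zeta(x)\zeta(y)$ and $\zeta(1)=1$, where $1$ is the empty hypergraph over $\emptyset$. It is a characteristic function if its values on simple hypergraphs lie in $\{0,1\}$, and it is odd if $\zeta(h)=0$ whenever some connected component of $h$ has an even number of vertices (isolated vertices are components). For $h$ over $V$ and $n\in\mathbb N$ let $$\chi^\zeta_V(h)(n)=\sum_{V=V_1\sqcup\dots\sqcup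 V_n}\zeta_V\circ\mu_{V_1,\dots,V_n}\circ\Delta_{V_1,\dots,V_n}(h),$$ the sum being over all sequences of $n$ pairwise disjoint, possibly empty, sets with union $V$. An (admissible) orientation $f$ of $h$ assigns to each edge $e$ a non-empty subset $f(e)\subseteq e$; let $f_s(e)=e\setminus f(e)$ and $f(h)=\{f(e):e\in h\}$, a simple hypergraph over $V$. It is acyclic if there is no sequence of distinct edges $e_1,\dots,e_k$, $k\ge 1$, such that for each $1\le i<k$ one has $f(e_i)\cap f_s(e_{i+1})\neq\emptyset$ or $\emptyset\subsetneq f(e_i)\cap e_{i+1}\subsetneq f(e_{i+1})$, and $f(e_k)\cap f_s(e_1)\ne\emptyset$. Let $\mathcal A_h$ be the set of acyclic orientations of $h$. An orientation $f$ is a $\zeta$-orientation if $\zeta(f(h))\neq 0$. A coloring $c:V\to[n]$ is compatible with $f$ if for each edge $e$ every vertex of $f(e)$ has maximal color in $e$, and strictly compatible if for each edge $e$ the set $f(e)$ is exactly the set of vertices of maximal color in $e$; $C_{h,f,n}$ and $C^{\circ}_{h,f,n}$ are the sets of compatible and strictly compatible colorings. Let $\mathrm{cc}(h)$ be the number of connected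 components of $h$. Proposition. Let $\zeta$ be a character of $\mathrm{SHG}$, $V$ a finite set and $h$ a simple hypergraph over $V$. Then $\chi^\zeta_V(h)$ is given on $\mathbb N$ by a (unique) polynomial over $\mathbb K$, through which $\chi^\zeta_V(h)(-n)$ is defined, and for all $n\in\mathbb N$ $$\chi^\zeta_V(h)(n)=\sum_{f\in\mathcal A_h}\zeta(f(h))\,|C^{\circ}_{h,f,n}|,\qquad \chi^\zeta_V(h)(-n)=\sum_{f\in\mathcal A_h}(-1)^{\mathrm{cc}(f(h))}\zeta(f(h))\,|C_{h,f,n}|.$$ If $\zeta$ is a characteristic function, then $\chi^\zeta_V(h)(n)$ is the number of pairs $(f,c)$ of an acyclic $\zeta$-orientation $f$ of $h$ and a coloring $c$ of $V$ with $[n]$ that are strictly compatible. If moreover $\zeta$ is odd, then $(-1)^{|V|}\chi^\zeta_V(h)(-n)$ is the number of such pairs that are compatible; in particular $(-1)^{|V|}\chi^\zeta_V(h)(-1)$ is the number of acyclic $\zeta$-orientations of $h$. -/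

import Mathlib

open scoped TensorProduct

namespace HopfSHG

/-! Finite sets are the finite subsets of an arbitrary type `α` of labels. -/

/-- A simple hypergraph over the finite set `V`: a set of non-empty subsets of `V`. -/
@[ext]
structure SimpleHypergraph {α : Type*} (V : Finset α) where
  edges : Finset (Finset α)
  nonempty_of_mem : ∀ e ∈ edges, e.Nonempty
  subset_of_mem : ∀ e ∈ edges, e ⊆ V

namespace SimpleHypergraph

variable {α : Type*} [DecidableEq α]

/-- The unique simple hypergraph over the empty set. -/
def empty : SimpleHypergraph (∅ : Finset α) where
  edges := ∅
  nonempty_of_mem := by simp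
  subset_of_mem := by simp

/-- `h₁ ⊔ h₂`, a simple hypergraph over `V = V₁ ⊔ V₂`. -/
def union {V₁ V₂ V : Finset α} (hV : V₁ ∪ V₂ = V) (h₁ : SimpleHypergraph V₁)
    (h₂ : SimpleHypergraph V₂) : SimpleHypergraph V where
  edges := h₁.edges ∪ h₂.edges
  nonempty_of_mem := by
    intro e he
    rcases Finset.mem_union.1 he with he | he
    · exact h₁.nonempty_of_mem e he
    · exact h₂.nonempty_of_mem e he
  subset_of_mem := by
    intro e he
    subst hV
    rcases Finset.mem_union.1 he with he | he
    · exact (h₁.subset_of_mem e he).trans Finset.subset_union_left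
    · exact (h₂.subset_of_mem e he).trans Finset.subset_union_right

/-- The restriction `h|_{V₁} = {e ∈ h | e ⊆ V₁}`. -/
def restrict {V : Finset α} (h : SimpleHypergraph V) (V₁ : Finset α) :
    SimpleHypergraph V₁ where
  edges := h.edges.filter (fun e => e ⊆ V₁)
  nonempty_of_mem := fun e he => h.nonempty_of_mem e (Finset.mem_filter.1 he).1
  subset_of_mem := fun _ he => (Finset.mem_filter.1 he).2

/-- The contraction `h/_{V₁} = {e ∩ V₁ᶜ | e ∈ h, e ⊈ V₁}`, over `V₂ = V \ V₁`. -/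
def contract {V₁ V₂ V : Finset α} (hV : V₁ ∪ V₂ = V) (h : SimpleHypergraph V) :
    SimpleHypergraph V₂ where
  edges := (h.edges.filter (fun e => ¬ e ⊆ V₁)).image (fun e => e \ V₁)
  nonempty_of_mem := by
    intro e he
    obtain ⟨e', he', rfl⟩ := Finset.mem_image.1 he
    exact Finset.sdiff_nonempty.2 (Finset.mem_filter.1 he').2
  subset_of_mem := by
    intro e he
    obtain ⟨e', he', rfl⟩ := Finset.mem_image.1 he
    have h1 : e' ⊆ V := h.subset_of_mem e' (Finset.mem_filter.1 he').1
    rw [← hV] at h1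
    exact sdiff_le_iff.2 h1

/-- Two distinct vertices are adjacent when they share an edge. -/
def vertexGraph {V : Finset α} (h : SimpleHypergraph V) : SimpleGraph {v // v ∈ V} where
  Adj v w := v ≠ w ∧ ∃ e ∈ h.edges, (v : α) ∈ e ∧ (w : α) ∈ e
  symm := ⟨fun _ _ ⟨hne, e, he, hv, hw⟩ => ⟨hne.symm, e, he, hw, hv⟩⟩
  loopless := ⟨fun _ hv => hv.1 rfl⟩

/-- The number of connected components of `h` (isolated vertices are components). -/
noncomputable def cc {V : Finset α} (h : SimpleHypergraph V) : ℕ :=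
  Nat.card h.vertexGraph.ConnectedComponent

end SimpleHypergraph

/-! ### The structure maps of the Hopf monoid -/

/-- The linear species of simple hypergraphs: formal linear combinations of simple hypergraphs
over `V`. -/
abbrev SHG (K : Type*) [Field K] {α : Type*} (V : Finset α) : Type _ :=
  SimpleHypergraph V →₀ K

section Hopf

variable (K : Type*) [Field K] {α : Type*} [DecidableEq α]

/-- A simple hypergraph as a basis element. -/
noncomputable def single {V : Finset α} (h : SimpleHypergraph V) : SHG K V :=
  Finsupp.single h 1

/-- The unit, spanning the one-dimensional space `SHG[∅]`. -/
noncomputable def unit : SHG K (∅ : Finset α) :=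
  single K SimpleHypergraph.empty

/-- The product `μ_{V₁,V₂} : h₁ ⊗ h₂ ↦ h₁ ⊔ h₂`, used for disjoint `V₁`, `V₂`. -/
noncomputable def mul {V₁ V₂ V : Finset α} (hV : V₁ ∪ V₂ = V) :
    SHG K V₁ ⊗[K] SHG K V₂ →ₗ[K] SHG K V :=
  TensorProduct.lift
    (Finsupp.linearCombination K fun h₁ : SimpleHypergraph V₁ =>
      Finsupp.linearCombination K fun h₂ : SimpleHypergraph V₂ =>
        single K (SimpleHypergraph.union hV h₁ h₂))

/-- The coproduct `Δ_{V₁,V₂} : h ↦ h|_{V₁} ⊗ h/_{V₁}`, used for disjoint `V₁`, `V₂`. -/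
noncomputable def comul {V₁ V₂ V : Finset α} (hV : V₁ ∪ V₂ = V) :
    SHG K V →ₗ[K] SHG K V₁ ⊗[K] SHG K V₂ :=
  Finsupp.linearCombination K fun h : SimpleHypergraph V =>
    single K (h.restrict V₁) ⊗ₜ[K] single K (SimpleHypergraph.contract hV h)

theorem head_union_tail {n : ℕ} {D : Fin (n + 1) → Finset α} {V : Finset α}
    (hD : Finset.univ.biUnion D = V) :
    D 0 ∪ Finset.univ.biUnion (fun i : Fin n => D i.succ) = V := by
  rw [← hD]
  ext v
  simp [Fin.exists_fin_succ]

/-- The iterated product `μ_{V₁,…,Vₙ} : SHG[V₁] ⊗ ⋯ ⊗ SHG[Vₙ] → SHG[V]`, as a multilinear map. -/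
noncomputable def mulMultilinear : (n : ℕ) → (D : Fin n → Finset α) → (V : Finset α) →
    Finset.univ.biUnion D = V → MultilinearMap K (fun i => SHG K (D i)) (SHG K V)
  | 0, _, _, hD => MultilinearMap.constOfIsEmpty K _
      (single K ⟨∅, by simp, by simp⟩)
  | n + 1, D, _, hD => LinearMap.uncurryLeft
      { toFun := fun x =>
          ((mul K (head_union_tail hD)) ∘ₗ TensorProduct.mk K _ _ x).compMultilinearMap
            (mulMultilinear n (fun i => D i.succ) _ rfl)
        map_add' := by
          intro x y
          ext m : 1
          simp
        map_smul' := by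
          intro c x
          ext m : 1
          simp }

/-- The iterated product `μ_{V₁,…,Vₙ} : SHG[V₁] ⊗ ⋯ ⊗ SHG[Vₙ] → SHG[V]`. -/
noncomputable def mulIter {n : ℕ} (D : Fin n → Finset α) {V : Finset α}
    (hD : Finset.univ.biUnion D = V) :
    (⨂[K] i, SHG K (D i)) →ₗ[K] SHG K V :=
  PiTensorProduct.lift (mulMultilinear K n D V hD)

/-- The iterated coproduct `Δ_{V₁,…,Vₙ} : SHG[V] → SHG[V₁] ⊗ ⋯ ⊗ SHG[Vₙ]`, which is
`(id ⊗ Δ_{V₂,…,Vₙ}) ∘ Δ_{V₁,V₂⊔⋯⊔Vₙ}`. For `n = 0` (so `V = ∅`) it is the identification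
of `SHG[∅]` with the field. -/
noncomputable def comulIter : (n : ℕ) → (D : Fin n → Finset α) → (V : Finset α) →
    Finset.univ.biUnion D = V → (SHG K V →ₗ[K] ⨂[K] i, SHG K (D i))
  | 0, _, _, _ => Finsupp.linearCombination K
      (fun _ => PiTensorProduct.tprod K (fun i => Fin.elim0 i))
  | n + 1, D, _, hD =>
      TensorProduct.lift
        ((PiTensorProduct.lift (R := K)).toLinearMap ∘ₗ
          (PiTensorProduct.tprod K (s := fun i => SHG K (D i))).curryLeft) ∘ₗ
      LinearMap.lTensor (SHG K (D 0)) (comulIter n (fun i => D i.succ) _ rfl) ∘ₗ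
      comul K (head_union_tail hD)

/-- A character: linear forms `ζ_V` on `SHG[V]`, compatible with the product and the unit. -/
structure Character (α : Type*) [DecidableEq α] where
  toLin : (V : Finset α) → SHG K V →ₗ[K] K
  map_mul : ∀ (V₁ V₂ V : Finset α) (_ : Disjoint V₁ V₂) (hV : V₁ ∪ V₂ = V)
    (x : SHG K V₁) (y : SHG K V₂),
    toLin V (mul K hV (x ⊗ₜ[K] y)) = toLin V₁ x * toLin V₂ y
  map_unit : toLin ∅ (unit K) = 1

end Hopf

section Invariant

variable {K : Type*} [Field K] {α : Type*} [DecidableEq α]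

/-- The value of a character on a simple hypergraph. -/
noncomputable def Character.val (ζ : Character K α) {V : Finset α} (h : SimpleHypergraph V) : K :=
  ζ.toLin V (single K h)

/-- A characteristic function: a character with values `0` and `1` on simple hypergraphs. -/
def Character.IsCharacteristic (ζ : Character K α) : Prop :=
  ∀ (V : Finset α) (h : SimpleHypergraph V), ζ.val h = 0 ∨ ζ.val h = 1

/-- An odd character vanishes on every `h` that has a connected component with an even number of
vertices. -/
def Character.IsOdd (ζ : Character K α) : Prop :=
  ∀ (V : Finset α) (h : SimpleHypergraph V),
    (∃ C : h.vertexGraph.ConnectedComponent, Even C.supp.ncard) → ζ.val h = 0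

/-- The decompositions of `V` of length `n`: sequences of `n` pairwise disjoint, possibly empty,
sets with union `V`. -/
def Decomposition (V : Finset α) (n : ℕ) : Type _ :=
  {D : Fin n → Finset α // Pairwise (fun i j => Disjoint (D i) (D j)) ∧ Finset.univ.biUnion D = V}

noncomputable instance (V : Finset α) (n : ℕ) : Fintype (Decomposition V n) :=
  @Fintype.ofFinite _ <| Finite.of_injective
    (fun (D : Decomposition V n) (i : Fin n) =>
      (⟨D.1 i, Finset.mem_powerset.2
        ((Finset.subset_biUnion_of_mem D.1 (Finset.mem_univ i)).trans D.2.2.subset)⟩ : {S // S ∈ V.powerset}))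
    (fun _ _ hDE => Subtype.ext (funext fun i => congrArg Subtype.val (congrFun hDE i)))

/-- `χ^ζ_V(x)(n)`: the sum of `ζ_V ∘ μ_{V₁,…,Vₙ} ∘ Δ_{V₁,…,Vₙ} (x)` over all decompositions
`V = V₁ ⊔ ⋯ ⊔ Vₙ`. -/
noncomputable def chi (ζ : Character K α) {V : Finset α} (x : SHG K V) (n : ℕ) : K :=
  ∑ D : Decomposition V n, ζ.toLin V (mulIter K D.1 D.2.2 (comulIter K n D.1 V D.2.2 x))

end Invariant

/-! ### Orientations and colorings -/

section Orientations

variable {α : Type*} [DecidableEq α] {V : Finset α}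

/-- An admissible orientation of `h`: a map `f` from the edges to the non-empty subsets of `V` with
`f e ⊆ e` for every edge `e`. -/
@[ext]
structure Orientation (h : SimpleHypergraph V) where
  toFun : {e // e ∈ h.edges} → Finset α
  nonempty : ∀ e, (toFun e).Nonempty
  subset : ∀ e, toFun e ⊆ e.1

noncomputable instance (h : SimpleHypergraph V) : Fintype (Orientation h) :=
  @Fintype.ofFinite _ <| Finite.of_injective
    (fun (f : Orientation h) (e : {e // e ∈ h.edges}) =>
      (⟨f.toFun e, Finset.mem_powerset.2 ((f.subset e).trans (h.subset_of_mem _ e.2))⟩ :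
        {S // S ∈ V.powerset}))
    (fun _ _ hfg => Orientation.ext (funext fun e => congrArg Subtype.val (congrFun hfg e)))

namespace Orientation

variable {h : SimpleHypergraph V}

/-- The complement `f_s(e) = e \ f(e)` of the target of an edge. -/
def source (f : Orientation h) (e : {e // e ∈ h.edges}) : Finset α :=
  e.1 \ f.toFun e

/-- There is no sequence `e₁, …, e_k` of distinct edges such that, for `1 ≤ i < k`,
`f(e_i) ∩ f_s(e_{i+1}) ≠ ∅` or `∅ ⊊ f(e_i) ∩ e_{i+1} ⊊ f(e_{i+1})`, and
`f(e_k) ∩ f_s(e₁) ≠ ∅`. -/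
def IsAcyclic (f : Orientation h) : Prop :=
  ¬ ∃ (m : ℕ) (e : Fin (m + 1) → {e // e ∈ h.edges}), Function.Injective e ∧
    (∀ i : Fin m,
      (f.toFun (e i.castSucc) ∩ f.source (e i.succ)).Nonempty ∨
      ((f.toFun (e i.castSucc) ∩ (e i.succ).1).Nonempty ∧
        f.toFun (e i.castSucc) ∩ (e i.succ).1 ⊂ f.toFun (e i.succ))) ∧
    (f.toFun (e (Fin.last m)) ∩ f.source (e 0)).Nonempty

/-- The image `f(h) = {f(e) | e ∈ h}`, a simple hypergraph over `V`. -/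
def image (f : Orientation h) : SimpleHypergraph V where
  edges := Finset.univ.image f.toFun
  nonempty_of_mem := by
    intro e he
    obtain ⟨e', -, rfl⟩ := Finset.mem_image.1 he
    exact f.nonempty e'
  subset_of_mem := by
    intro e he
    obtain ⟨e', -, rfl⟩ := Finset.mem_image.1 he
    exact (f.subset e').trans (h.subset_of_mem _ e'.2)

end Orientation

/-- `v` is a vertex of maximal color in `e`. -/
def IsMaxVertex {n : ℕ} (c : {v // v ∈ V} → Fin n) (e : Finset α) (v : {v // v ∈ V}) : Prop :=
  (v : α) ∈ e ∧ ∀ w : {v // v ∈ V}, (w : α) ∈ e → c w ≤ c v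

/-- The colorings of `V` with `n` colors compatible with `f`: the elements of `f(e)` are maximal
in `e`, for every edge `e`. The colors are the elements of `Fin n`. -/
def colorings (h : SimpleHypergraph V) (f : Orientation h) (n : ℕ) :
    Set ({v // v ∈ V} → Fin n) :=
  {c | ∀ (e : {e // e ∈ h.edges}) (v : {v // v ∈ V}), (v : α) ∈ f.toFun e → IsMaxVertex c e.1 v}

/-- The colorings of `V` with `n` colors strictly compatible with `f`: `f(e)` is exactly the set of
maximal elements of `e`, for every edge `e`. -/
def strictColorings (h : SimpleHypergraph V) (f : Orientation h) (n : ℕ) :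
    Set ({v // v ∈ V} → Fin n) :=
  {c | ∀ (e : {e // e ∈ h.edges}) (v : {v // v ∈ V}), (v : α) ∈ f.toFun e ↔ IsMaxVertex c e.1 v}

open Classical in
/-- The finite set of acyclic orientations of `h`. -/
noncomputable def acyclicOrientations (h : SimpleHypergraph V) : Finset (Orientation h) :=
  Finset.univ.filter fun f => f.IsAcyclic

/-- The set of acyclic `ζ`-orientations of `h`: the acyclic orientations `f` with `ζ(f(h)) ≠ 0`. -/
def acyclicZetaOrientations {K : Type*} [Field K] (ζ : Character K α) (h : SimpleHypergraph V) :
    Set (Orientation h) :=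
  {f | f.IsAcyclic ∧ ζ.val f.image ≠ 0}

end Orientations

end HopfSHG

open HopfSHG

/-! A decomposition of `V` into `n` blocks is a coloring `c : V → [n]`. Contraction deletes from an
edge its vertices in earlier blocks until the rest lies in one block, so the composite `μ ∘ Δ` sends
`h` to `f(h)`, where `f(e)` is the set of vertices of `e` of maximal color. Hence `χ(n)` is the sum
of `ζ(f(h))` over all colorings, `f` being the one orientation strictly compatible with the coloring
(`chi_single_eq_sum`). Such an `f` is acyclic, because colors cannot increase around a cycle;
grouping the colorings by `f` gives the first formula.

For fixed acyclic `f`, compatible colorings are constant on the components of `f(h)`. They are the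
weakly increasing maps on the digraph of components with arrows from the sources of an edge to its
target; strict compatibility means strictly increasing. Acyclicity of `f` makes this digraph
acyclic, so Stanley's reciprocity for order polynomials (`exists_order_polynomial`) applies with
sign `(-1)^cc(f(h))`. For odd `ζ` only components of odd size contribute, and the sign becomes
`(-1)^|V|`. -/

namespace HopfSHG

/-! ### Order polynomials of finite digraphs and their reciprocity -/

section OrderPolynomial

open Finset Polynomial

theorem exists_polynomial_sum_range (g : ℚ[X]) :
    ∃ p : ℚ[X], ∀ n : ℕ, p.eval (n : ℚ) = ∑ k ∈ range n, g.eval (k : ℚ) := by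
  induction g using Polynomial.induction_on' with
  | add g₁ g₂ h₁ h₂ =>
    obtain ⟨p₁, hp₁⟩ := h₁
    obtain ⟨p₂, hp₂⟩ := h₂
    exact ⟨p₁ + p₂, fun n => by simp [hp₁, hp₂, sum_add_distrib]⟩
  | monomial d a =>
    -- Faulhaber's formula for the sum of the `d`-th powers.
    refine ⟨C a * ∑ i ∈ range (d + 1),
      C (_root_.bernoulli i * ((d + 1).choose i) / (d + 1)) * X ^ (d + 1 - i), fun n => ?_⟩
    simp only [eval_mul, eval_C, eval_finsetSum, eval_pow, eval_X, eval_monomial]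
    rw [← mul_sum, sum_range_pow]
    congr 1
    refine sum_congr rfl fun i _ => ?_
    ring

theorem polynomial_eq_of_eval_natCast {p q : ℚ[X]}
    (h : ∀ n : ℕ, p.eval (n : ℚ) = q.eval (n : ℚ)) : p = q := by
  refine Polynomial.eq_of_infinite_eval_eq p q ?_
  refine (Set.infinite_range_of_injective (Nat.cast_injective (R := ℚ))).mono ?_
  rintro _ ⟨n, rfl⟩
  exact h n

variable {P : Type*} [Fintype P] [DecidableEq P]

open Classical in
/-- The maps `J → {0, …, n - 1}`, extended by `0`, that send the arrows of `r` between elements of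
`J` to pairs related by `s`. -/
noncomputable def arrowMaps (r : P → P → Prop) (s : ℕ → ℕ → Prop) (n : ℕ) (J : Finset P) :
    Finset (P → ℕ) :=
  (Fintype.piFinset fun a => if a ∈ J then range n else {0}).filter
    fun c => ∀ a ∈ J, ∀ b ∈ J, r a b → s (c a) (c b)

open Classical in
/-- The elements of `J` without an arrow to an element of `J`. -/
noncomputable def sinks (r : P → P → Prop) (J : Finset P) : Finset P :=
  J.filter fun a => ∀ b ∈ J, ¬ r a b

variable {r : P → P → Prop} {s : ℕ → ℕ → Prop}

theorem mem_arrowMaps {n : ℕ} {J : Finset P} {c : P → ℕ} :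
    c ∈ arrowMaps r s n J ↔ (∀ a ∈ J, c a < n) ∧ (∀ a ∉ J, c a = 0) ∧
      ∀ a ∈ J, ∀ b ∈ J, r a b → s (c a) (c b) := by
  simp only [arrowMaps, mem_filter, Fintype.mem_piFinset, ← and_assoc]
  refine and_congr_left fun _ => ⟨fun h => ⟨fun a ha => ?_, fun a ha => ?_⟩, fun h a => ?_⟩
  · simpa [ha] using h a
  · simpa [ha] using h a
  · by_cases ha : a ∈ J
    · simpa [ha] using h.1 a ha
    · simpa [ha] using h.2 a ha

theorem mem_sinks {J : Finset P} {a : P} : a ∈ sinks r J ↔ a ∈ J ∧ ∀ b ∈ J, ¬ r a b := by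
  simp [sinks]

theorem sinks_subset {J : Finset P} : sinks r J ⊆ J := fun _ ha => (mem_sinks.1 ha).1

/-- Extending a map by the top colour `n` on a set of sinks. -/
theorem card_arrowMaps_sdiff {J A : Finset P} (hA : A ⊆ sinks r J) {m n : ℕ}
    (hs : ∀ x < m, s x n) (T : Finset (P → ℕ))
    (hT : ∀ c, c ∈ T ↔ (∀ a ∈ A, c a = n) ∧ (∀ a ∈ J \ A, c a < m) ∧ (∀ a ∉ J, c a = 0) ∧
      ∀ a ∈ J, ∀ b ∈ J, r a b → s (c a) (c b)) :
    #(arrowMaps r s m (J \ A)) = #T := by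
  have hAJ : A ⊆ J := hA.trans sinks_subset
  refine card_bij' (fun c _ a => if a ∈ A then n else c a) (fun c _ a => if a ∈ A then 0 else c a)
    ?_ ?_ ?_ ?_
  · intro c hc
    rw [mem_arrowMaps] at hc
    obtain ⟨h1, h2, h3⟩ := hc
    rw [hT]
    refine ⟨fun a ha => by simp [ha], fun a ha => ?_, fun a ha => ?_, fun a ha b hb hab => ?_⟩
    · simpa [(mem_sdiff.1 ha).2] using h1 a ha
    · have : a ∉ A := fun h => ha (hAJ h)
      simpa [this] using h2 a (fun h => ha (mem_sdiff.1 h).1)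
    -- An arrow inside `J` never starts at a sink, so its head alone can receive the new color `n`;
    -- `hs` covers that case.
    · have haA : a ∉ A := fun h => (mem_sinks.1 (hA h)).2 b hb hab
      have ha' : a ∈ J \ A := mem_sdiff.2 ⟨ha, haA⟩
      by_cases hbA : b ∈ A
      · simpa [haA, hbA] using hs _ (h1 a ha')
      · simpa [haA, hbA] using h3 a ha' b (mem_sdiff.2 ⟨hb, hbA⟩) hab
  · intro c hc
    rw [hT] at hc
    obtain ⟨h1, h2, h3, h4⟩ := hc
    rw [mem_arrowMaps]
    refine ⟨fun a ha => ?_, fun a ha => ?_, fun a ha b hb hab => ?_⟩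
    · simpa [(mem_sdiff.1 ha).2] using h2 a ha
    · by_cases haA : a ∈ A
      · simp [haA]
      · simpa [haA] using h3 a (fun h => ha (mem_sdiff.2 ⟨h, haA⟩))
    · rw [mem_sdiff] at ha hb
      simpa [ha.2, hb.2] using h4 a ha.1 b hb.1 hab
  · intro c hc
    rw [mem_arrowMaps] at hc
    funext a
    by_cases ha : a ∈ A
    · simp [ha, hc.2.1 a]
    · simp [ha]
  · intro c hc
    rw [hT] at hc
    funext a
    by_cases ha : a ∈ A
    · simp [ha, hc.1 a ha]
    · simp [ha]

/-- Sort the maps by the set `A` of elements with the top color `n`: nothing lies strictly above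
`n`, so `A` consists of sinks. -/
theorem card_strict_succ (n : ℕ) (J : Finset P) :
    #(arrowMaps r (· < ·) (n + 1) J) =
      ∑ A ∈ (sinks r J).powerset, #(arrowMaps r (· < ·) n (J \ A)) := by
  rw [card_eq_sum_card_fiberwise (f := fun c => J.filter fun a => c a = n)
    (t := (sinks r J).powerset)]
  · refine sum_congr rfl fun A hA => ?_
    rw [mem_powerset] at hA
    refine (card_arrowMaps_sdiff hA (fun x hx => hx) _ fun c => ?_).symm
    rw [mem_filter, mem_arrowMaps]
    constructor
    · rintro ⟨⟨h1, h2, h3⟩, rfl⟩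
      refine ⟨fun a ha => (mem_filter.1 ha).2, fun a ha => ?_, h2, h3⟩
      simp only [mem_sdiff, mem_filter, not_and] at ha
      have := h1 a ha.1
      have := ha.2 ha.1
      omega
    · rintro ⟨h1, h2, h3, h4⟩
      have hAJ : A ⊆ J := hA.trans sinks_subset
      refine ⟨⟨fun a ha => ?_, h3, h4⟩, ?_⟩
      · by_cases haA : a ∈ A
        · simp [h1 a haA]
        · exact (h2 a (mem_sdiff.2 ⟨ha, haA⟩)).trans (Nat.lt_succ_self n)
      · ext a
        rw [mem_filter]
        refine ⟨fun ha => ?_, fun ha => ⟨hAJ ha, h1 a ha⟩⟩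
        by_contra haA
        exact (h2 a (mem_sdiff.2 ⟨ha.1, haA⟩)).ne ha.2
  · intro c hc
    rw [mem_coe, mem_arrowMaps] at hc
    rw [mem_coe, mem_powerset]
    intro a ha
    rw [mem_filter] at ha
    refine mem_sinks.2 ⟨ha.1, fun b hb hab => ?_⟩
    have h1 := hc.2.2 a ha.1 b hb hab
    have h2 := hc.1 b hb
    omega

/-- Weak maps do not decrease along arrows, so the top color propagates forward, and
well-foundedness makes the path stop at a sink. -/
theorem exists_sink_of_top (hr : WellFounded fun a b => r b a) {n : ℕ} {J : Finset P} {c : P → ℕ}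
    (hc : c ∈ arrowMaps r (· ≤ ·) (n + 1) J) {a : P} (ha : a ∈ J) (hca : c a = n) :
    ∃ b ∈ sinks r J, c b = n := by
  rw [mem_arrowMaps] at hc
  induction a using hr.induction with
  | _ a ih =>
    by_cases h : ∃ b ∈ J, r a b
    · obtain ⟨b, hb, hab⟩ := h
      refine ih b hab hb ?_
      have h1 := hc.2.2 a ha b hb hab
      have h2 := hc.1 b hb
      omega
    · push Not at h
      exact ⟨a, mem_sinks.2 ⟨ha, h⟩, hca⟩

/-- Inclusion-exclusion: a map `c` is counted with sign once for every set `A` of top-colored sinks.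
The signs cancel unless there is no such sink, and then the top color is not used at all. -/
theorem sum_neg_one_pow_card_weak (hr : WellFounded fun a b => r b a) (n : ℕ) (J : Finset P) :
    ∑ A ∈ (sinks r J).powerset, (-1 : ℤ) ^ #A * #(arrowMaps r (· ≤ ·) (n + 1) (J \ A)) =
      #(arrowMaps r (· ≤ ·) n J) := by
  have h1 : ∀ A ∈ (sinks r J).powerset,
      (-1 : ℤ) ^ #A * #(arrowMaps r (· ≤ ·) (n + 1) (J \ A)) =
      ∑ c ∈ arrowMaps r (· ≤ ·) (n + 1) J,
        if A ⊆ (sinks r J).filter (fun a => c a = n) then (-1 : ℤ) ^ #A else 0 := by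
    intro A hA
    rw [mem_powerset] at hA
    have hAJ : A ⊆ J := hA.trans sinks_subset
    rw [← sum_filter, sum_const, nsmul_eq_mul, mul_comm]
    congr 2
    refine card_arrowMaps_sdiff hA (fun x hx => Nat.lt_succ_iff.1 hx) _ fun c => ?_
    rw [mem_filter, mem_arrowMaps]
    constructor
    · rintro ⟨⟨h1, h2, h3⟩, h4⟩
      exact ⟨fun a ha => (mem_filter.1 (h4 ha)).2, fun a ha => h1 a (mem_sdiff.1 ha).1, h2, h3⟩
    · rintro ⟨h1, h2, h3, h4⟩
      refine ⟨⟨fun a ha => ?_, h3, h4⟩, fun a ha => mem_filter.2 ⟨hA ha, h1 a ha⟩⟩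
      by_cases haA : a ∈ A
      · simp [h1 a haA]
      · exact h2 a (mem_sdiff.2 ⟨ha, haA⟩)
  rw [sum_congr rfl h1, sum_comm]
  have h2 : ∀ c ∈ arrowMaps r (· ≤ ·) (n + 1) J,
      (∑ A ∈ (sinks r J).powerset,
        if A ⊆ (sinks r J).filter (fun a => c a = n) then (-1 : ℤ) ^ #A else 0) =
      if c ∈ arrowMaps r (· ≤ ·) n J then 1 else 0 := by
    intro c hc
    rw [← sum_filter]
    have : (sinks r J).powerset.filter (fun A => A ⊆ (sinks r J).filter (fun a => c a = n)) =
        ((sinks r J).filter (fun a => c a = n)).powerset := by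
      ext A
      simp only [mem_filter, mem_powerset]
      exact ⟨fun h => h.2, fun h => ⟨h.trans (filter_subset _ _), h⟩⟩
    rw [this, sum_powerset_neg_one_pow_card]
    refine if_congr ?_ rfl rfl
    rw [filter_eq_empty_iff]
    constructor
    · intro h
      have hc' := mem_arrowMaps.1 hc
      refine mem_arrowMaps.2 ⟨fun a ha => ?_, hc'.2⟩
      refine lt_of_le_of_ne (Nat.lt_succ_iff.1 (hc'.1 a ha)) fun hca => ?_
      obtain ⟨b, hb, hcb⟩ := exists_sink_of_top hr hc ha hca
      exact h hb hcb
    · intro h a ha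
      exact ((mem_arrowMaps.1 h).1 a (sinks_subset ha)).ne
  rw [sum_congr rfl h2, ← sum_filter, sum_const, nsmul_eq_mul, mul_one]
  congr 2
  ext c
  rw [mem_filter, mem_arrowMaps, mem_arrowMaps]
  exact ⟨fun h => h.2, fun h => ⟨⟨fun a ha => (h.1 a ha).trans (Nat.lt_succ_self n), h.2⟩, h⟩⟩

theorem card_arrowMaps_zero (J : Finset P) :
    #(arrowMaps r s 0 J) = if J = ∅ then 1 else 0 := by
  split_ifs with h
  · subst h
    refine card_eq_one.2 ⟨fun _ => 0, ?_⟩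
    ext c
    simp [mem_arrowMaps, funext_iff]
  · refine card_eq_zero.2 (eq_empty_of_forall_notMem fun c hc => ?_)
    obtain ⟨a, ha⟩ := nonempty_iff_ne_empty.2 h
    exact absurd ((mem_arrowMaps.1 hc).1 a ha) (Nat.not_lt_zero _)

/-- In `card_strict_succ` the term `A = ∅` is the count for `J` itself with one color fewer. The
other terms therefore give the first difference, a polynomial by induction on `J`, and summation
keeps it polynomial. -/
theorem exists_strict_polynomial (r : P → P → Prop) (J : Finset P) :
    ∃ p : ℚ[X], ∀ n : ℕ, p.eval (n : ℚ) = #(arrowMaps r (· < ·) n J) := by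
  induction J using Finset.strongInduction with
  | H J ih =>
    choose! q hq using ih
    have hsub : ∀ A ∈ (sinks r J).powerset.erase ∅, J \ A ⊂ J := fun A hA => by
      rw [mem_erase, mem_powerset] at hA
      exact sdiff_ssubset (hA.2.trans sinks_subset) (nonempty_iff_ne_empty.2 hA.1)
    obtain ⟨p, hp⟩ := exists_polynomial_sum_range
      (∑ A ∈ (sinks r J).powerset.erase ∅, q (J \ A))
    refine ⟨p + C (#(arrowMaps r (· < ·) 0 J) : ℚ), fun n => ?_⟩
    rw [eval_add, eval_C, hp]
    induction n with
    | zero => simp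
    | succ n ihn =>
      rw [sum_range_succ, add_right_comm, ihn, card_strict_succ,
        ← add_sum_erase _ _ (empty_mem_powerset (sinks r J)), sdiff_empty, eval_finsetSum]
      push_cast
      rw [sum_congr rfl fun A hA => hq (J \ A) (hsub A hA) n]

/-- Reciprocity for strict and weak order polynomials. -/
theorem exists_order_polynomial (hr : WellFounded fun a b => r b a) :
    ∃ p : ℚ[X], (∀ n : ℕ, p.eval (n : ℚ) = #(arrowMaps r (· < ·) n univ)) ∧
      ∀ n : ℕ, p.eval (-(n : ℚ)) =
        (-1) ^ Fintype.card P * #(arrowMaps r (· ≤ ·) n univ) := by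
  choose p hp using exists_strict_polynomial r
  refine ⟨p univ, hp univ, ?_⟩
  -- The recursion holds at all natural numbers, hence as an identity of polynomials, and so at
  -- negative arguments too.
  have hsucc : ∀ (J : Finset P) (x : ℚ),
      (p J).eval (x + 1) = ∑ A ∈ (sinks r J).powerset, (p (J \ A)).eval x := by
    intro J x
    have : (p J).comp (X + C 1) = ∑ A ∈ (sinks r J).powerset, p (J \ A) := by
      refine polynomial_eq_of_eval_natCast fun n => ?_
      rw [eval_comp, eval_add, eval_X, eval_C, eval_finsetSum,
        ← Nat.cast_succ, hp, card_strict_succ]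
      push_cast
      exact sum_congr rfl fun A _ => (hp _ n).symm
    simpa [eval_comp, eval_finsetSum] using congrArg (Polynomial.eval x) this
  have key : ∀ (n : ℕ) (J : Finset P),
      (p J).eval (-(n : ℚ)) = (-1) ^ #J * #(arrowMaps r (· ≤ ·) n J) := by
    intro n
    induction n with
    | zero =>
      intro J
      have := hp J 0
      rw [card_arrowMaps_zero] at this ⊢
      simp only [Nat.cast_zero, neg_zero] at this ⊢
      rw [this]
      split_ifs with h <;> simp [h]
    | succ n ihn =>
      intro J
      induction J using Finset.strongInduction with
      | H J ihJ =>
        -- At `x = -(n + 1)` the left side is known from `ihn`, the term `A = ∅` is the wanted value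
        -- and `ihJ` gives the other terms. Up to the sign `(-1)^|J|` this is the weak recursion
        -- `sum_neg_one_pow_card_weak`.
        have h1 := hsucc J (-((n + 1 : ℕ) : ℚ))
        rw [show -((n + 1 : ℕ) : ℚ) + 1 = -(n : ℚ) by push_cast; ring, ihn J,
          ← add_sum_erase _ _ (empty_mem_powerset (sinks r J)), sdiff_empty] at h1
        have h2 : ∀ A ∈ (sinks r J).powerset.erase ∅,
            (p (J \ A)).eval (-((n + 1 : ℕ) : ℚ)) =
            (-1) ^ #J * ((-1) ^ #A * #(arrowMaps r (· ≤ ·) (n + 1) (J \ A))) := by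
          intro A hA
          rw [mem_erase, mem_powerset] at hA
          have hAJ := hA.2.trans sinks_subset
          rw [ihJ _ (sdiff_ssubset hAJ (nonempty_iff_ne_empty.2 hA.1)), ← mul_assoc, ← pow_add,
            ← card_sdiff_add_card_eq_card hAJ, add_assoc, pow_add, ← two_mul, pow_mul]
          simp
        rw [sum_congr rfl h2, ← mul_sum] at h1
        have h3 := congrArg (Int.cast : ℤ → ℚ) (sum_neg_one_pow_card_weak hr n J)
        rw [← add_sum_erase _ _ (empty_mem_powerset (sinks r J)), sdiff_empty] at h3
        push_cast at h3 h1 ⊢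
        simp only [card_empty, pow_zero, one_mul] at h3
        rw [← h3, mul_add] at h1
        linarith
  intro n
  rw [key, card_univ]

end OrderPolynomial

/-! ### The invariant as a sum over colorings -/

section Invariant

variable {K : Type*} [Field K] {α : Type*} [DecidableEq α]

theorem mul_single_single {V₁ V₂ V : Finset α} (hV : V₁ ∪ V₂ = V) (h₁ : SimpleHypergraph V₁)
    (h₂ : SimpleHypergraph V₂) :
    mul K hV (single K h₁ ⊗ₜ[K] single K h₂) = single K (SimpleHypergraph.union hV h₁ h₂) := by
  simp [mul, single]

theorem comul_single {V₁ V₂ V : Finset α} (hV : V₁ ∪ V₂ = V) (h : SimpleHypergraph V) :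
    comul K hV (single K h) =
      single K (h.restrict V₁) ⊗ₜ[K] single K (SimpleHypergraph.contract hV h) := by
  simp [comul, single]

/-- The part of `e` in the last block of `D` that meets `e`. -/
def lastPart : (n : ℕ) → (Fin n → Finset α) → Finset α → Finset α
  -- With no block left the value is a convention; returning `e` keeps non-empty sets non-empty.
  | 0, _, e => e
  | n + 1, D, e => if e ⊆ D 0 then e else lastPart n (fun i => D i.succ) (e \ D 0)

theorem lastPart_subset (n : ℕ) (D : Fin n → Finset α) (e : Finset α) : lastPart n D e ⊆ e := by
  induction n generalizing e with
  | zero => exact subset_rfl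
  | succ n ih =>
    rw [lastPart]
    split_ifs
    · exact subset_rfl
    · exact (ih _ _).trans Finset.sdiff_subset

theorem lastPart_nonempty (n : ℕ) (D : Fin n → Finset α) {e : Finset α} (he : e.Nonempty) :
    (lastPart n D e).Nonempty := by
  induction n generalizing e with
  | zero => exact he
  | succ n ih =>
    rw [lastPart]
    split_ifs with h
    · exact he
    · exact ih _ (Finset.sdiff_nonempty.2 h)

/-- The simple hypergraph of the last parts of the edges of `h`. -/
def lastParts {V : Finset α} (h : SimpleHypergraph V) {n : ℕ} (D : Fin n → Finset α) :
    SimpleHypergraph V where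
  edges := h.edges.image (lastPart n D)
  nonempty_of_mem := by
    intro e he
    obtain ⟨e', he', rfl⟩ := Finset.mem_image.1 he
    exact lastPart_nonempty n D (h.nonempty_of_mem e' he')
  subset_of_mem := by
    intro e he
    obtain ⟨e', he', rfl⟩ := Finset.mem_image.1 he
    exact (lastPart_subset n D e').trans (h.subset_of_mem e' he')

/-- An edge inside the first block survives in the restriction; any other loses that block in the
contraction, exactly as in the recursion of `lastPart`. -/
theorem union_lastParts {n : ℕ} {D : Fin (n + 1) → Finset α} {V : Finset α}
    (hD : Finset.univ.biUnion D = V) (h : SimpleHypergraph V) :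
    SimpleHypergraph.union (head_union_tail hD) (h.restrict (D 0))
      (lastParts (SimpleHypergraph.contract (head_union_tail hD) h) fun i => D i.succ) =
      lastParts h D := by
  ext e
  simp only [SimpleHypergraph.union, SimpleHypergraph.restrict, SimpleHypergraph.contract,
    lastParts, Finset.mem_union, Finset.mem_filter, Finset.mem_image, lastPart]
  constructor
  · rintro (⟨he, h0⟩ | ⟨_, ⟨e', ⟨he', h0⟩, rfl⟩, rfl⟩)
    · exact ⟨e, he, by simp [h0]⟩
    · exact ⟨e', he', by simp [h0]⟩
  · rintro ⟨e', he', rfl⟩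
    by_cases h0 : e' ⊆ D 0
    · exact Or.inl (by simp [h0, he'])
    · exact Or.inr ⟨_, ⟨e', ⟨he', h0⟩, rfl⟩, by simp [h0]⟩

/-- `comulIter` prepends its first tensor factor through `curryLeft`; the iterated product turns
this into one binary product, as is seen on pure tensors. -/
theorem mulIter_lift_curryLeft {n : ℕ} {D : Fin (n + 1) → Finset α} {V : Finset α}
    (hD : Finset.univ.biUnion D = V) (x : SHG K (D 0)) (t : ⨂[K] i : Fin n, SHG K (D i.succ)) :
    mulIter K D hD (PiTensorProduct.lift
      ((PiTensorProduct.tprod K (s := fun i => SHG K (D i))).curryLeft x) t) =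
      mul K (head_union_tail hD) (x ⊗ₜ[K] mulIter K (fun i => D i.succ) rfl t) := by
  induction t using PiTensorProduct.induction_on with
  | smul_tprod c m =>
    simp only [map_smul, PiTensorProduct.lift.tprod, MultilinearMap.curryLeft_apply, mulIter,
      TensorProduct.tmul_smul]
    simp [mulMultilinear]
  | add t₁ t₂ h₁ h₂ => simp only [map_add, h₁, h₂, TensorProduct.tmul_add]

theorem mulIter_comulIter_single (n : ℕ) (D : Fin n → Finset α) {V : Finset α}
    (hD : Finset.univ.biUnion D = V) (h : SimpleHypergraph V) :
    mulIter K D hD (comulIter K n D V hD (single K h)) = single K (lastParts h D) := by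
  induction n generalizing V with
  | zero =>
    have hV : V = ∅ := by rw [← hD]; simp
    subst hV
    have : ∀ g : SimpleHypergraph (∅ : Finset α), g = ⟨∅, by simp, by simp⟩ := fun g => by
      ext e
      simp only [Finset.notMem_empty, iff_false]
      intro he
      exact (g.nonempty_of_mem e he).ne_empty (Finset.subset_empty.1 (g.subset_of_mem e he))
    rw [this (lastParts h D)]
    simp [comulIter, mulIter, single, mulMultilinear]
  | succ n ih =>
    simp only [comulIter, LinearMap.comp_apply, comul_single, LinearMap.lTensor_tmul, TensorProduct.lift.tmul,
      LinearEquiv.coe_coe]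
    rw [mulIter_lift_curryLeft hD, ih, mul_single_single, union_lastParts hD]

/-- With block indices read as colors, the last part of `e` is its set of vertices of maximal color.
-/
theorem mem_lastPart {n : ℕ} {D : Fin n → Finset α}
    (hdisj : Pairwise fun i j => Disjoint (D i) (D j)) {e : Finset α}
    (he : e ⊆ Finset.univ.biUnion D) {v : α} {i : Fin n} (hv : v ∈ D i) :
    v ∈ lastPart n D e ↔ v ∈ e ∧ ∀ w ∈ e, ∀ j, w ∈ D j → j ≤ i := by
  induction n generalizing e with
  | zero => exact i.elim0
  | succ n ih =>
    rw [lastPart]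
    split_ifs with h
    · refine ⟨fun hve => ⟨hve, fun w hw j hj => ?_⟩, fun h => h.1⟩
      have : j = 0 := by
        by_contra hj0
        exact Finset.disjoint_left.1 (hdisj hj0) hj (h hw)
      exact this ▸ Fin.zero_le i
    · have hd' : Pairwise fun i j : Fin n => Disjoint (D i.succ) (D j.succ) :=
        fun i j hij => hdisj fun h => hij (Fin.succ_injective _ h)
      have he' : e \ D 0 ⊆ Finset.univ.biUnion fun i : Fin n => D i.succ := by
        intro w hw
        rw [Finset.mem_sdiff] at hw
        obtain ⟨j, -, hj⟩ := Finset.mem_biUnion.1 (he hw.1)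
        cases j using Fin.cases with
        | zero => exact absurd hj hw.2
        | succ j => exact Finset.mem_biUnion.2 ⟨j, Finset.mem_univ _, hj⟩
      cases i using Fin.cases with
      | zero =>
        constructor
        · intro hvl
          exact absurd hv (Finset.mem_sdiff.1 (lastPart_subset _ _ _ hvl)).2
        · rintro ⟨-, hmax⟩
          refine absurd (fun w hw => ?_) h
          obtain ⟨j, -, hj⟩ := Finset.mem_biUnion.1 (he hw)
          have := hmax w hw j hj
          rwa [Fin.le_zero_iff.1 this] at hj
      | succ i =>
        have hv0 : v ∉ D 0 := fun h0 =>
          Finset.disjoint_left.1 (hdisj (Fin.succ_ne_zero i)) hv h0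
        rw [ih hd' he' hv, Finset.mem_sdiff]
        constructor
        · rintro ⟨⟨hve, -⟩, hmax⟩
          refine ⟨hve, fun w hw j hj => ?_⟩
          cases j using Fin.cases with
          | zero => exact Fin.zero_le _
          | succ j =>
            refine Fin.succ_le_succ_iff.2 (hmax w (Finset.mem_sdiff.2 ⟨hw, fun h0 => ?_⟩) j hj)
            exact Finset.disjoint_left.1 (hdisj (Fin.succ_ne_zero j)) hj h0
        · rintro ⟨hve, hmax⟩
          refine ⟨⟨hve, hv0⟩, fun w hw j hj => ?_⟩
          exact Fin.succ_le_succ_iff.1 (hmax w (Finset.mem_sdiff.1 hw).1 j.succ hj)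

/-- The block of a decomposition that contains a vertex. -/
theorem Decomposition.exists_mem {V : Finset α} {n : ℕ} (D : Decomposition V n)
    (v : {v // v ∈ V}) : ∃ i, (v : α) ∈ D.1 i := by
  have := D.2.2.symm.subset v.2
  simpa using this

/-- The decompositions of `V` of length `n` are the colorings of `V` with `n` colors. -/
noncomputable def decompositionEquiv (V : Finset α) (n : ℕ) :
    Decomposition V n ≃ ({v // v ∈ V} → Fin n) where
  toFun D v := (D.exists_mem v).choose
  invFun c := ⟨fun i => (Finset.univ.filter fun v => c v = i).map (Function.Embedding.subtype _), by
    refine ⟨fun i j hij => Finset.disjoint_left.2 fun v hv hv' => ?_, ?_⟩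
    · simp only [Finset.mem_map, Finset.mem_filter, Finset.mem_univ, true_and] at hv hv'
      obtain ⟨w, rfl, rfl⟩ := hv
      obtain ⟨w', rfl, hw⟩ := hv'
      exact hij (congrArg c (Subtype.ext hw.symm))
    · ext v
      simp⟩
  left_inv D := by
    refine Subtype.ext (funext fun i => Finset.ext fun v => ?_)
    simp only [Finset.mem_map, Finset.mem_filter, Finset.mem_univ, true_and]
    constructor
    · rintro ⟨w, rfl, rfl⟩
      exact (D.exists_mem w).choose_spec
    · intro hv
      have hvV : v ∈ V := D.2.2.subset (Finset.mem_biUnion.2 ⟨i, Finset.mem_univ _, hv⟩)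
      refine ⟨⟨v, hvV⟩, ?_, rfl⟩
      by_contra hne
      exact Finset.disjoint_left.1 (D.2.1 hne) (D.exists_mem ⟨v, hvV⟩).choose_spec hv
  right_inv c := by
    have key : ∀ D : Decomposition V n, (∀ i, ∀ v : {v // v ∈ V}, (v : α) ∈ D.1 i → c v = i) →
        (fun v => (D.exists_mem v).choose) = c := fun D hD =>
      funext fun v => (hD _ v (D.exists_mem v).choose_spec).symm
    exact key _ fun i v hv => by simpa using hv

theorem mem_decompositionEquiv {V : Finset α} {n : ℕ} (D : Decomposition V n) (v : {v // v ∈ V}) :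
    (v : α) ∈ D.1 (decompositionEquiv V n D v) :=
  (D.exists_mem v).choose_spec

variable {V : Finset α} {h : SimpleHypergraph V}

/-- The orientation of `h` by the vertices of maximal color. -/
noncomputable def maxOrientation (h : SimpleHypergraph V) {n : ℕ} (c : {v // v ∈ V} → Fin n) :
    Orientation h where
  toFun e := by
    classical
    exact (Finset.univ.filter fun v => IsMaxVertex c e.1 v).map (Function.Embedding.subtype _)
  nonempty e := by
    obtain ⟨v, hv⟩ := h.nonempty_of_mem e.1 e.2
    have hvV := h.subset_of_mem e.1 e.2 hv
    obtain ⟨w, hw, hmax⟩ := Finset.exists_max_image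
      (Finset.univ.filter fun w : {v // v ∈ V} => (w : α) ∈ e.1) c
      ⟨⟨v, hvV⟩, by simpa using hv⟩
    refine ⟨w, ?_⟩
    simp only [Finset.mem_map, Finset.mem_filter, Finset.mem_univ, true_and] at hw ⊢
    exact ⟨w, ⟨hw, fun u hu => hmax u (by simpa using hu)⟩, rfl⟩
  subset e := by
    intro v hv
    simp only [Finset.mem_map, Finset.mem_filter, Finset.mem_univ, true_and] at hv
    obtain ⟨w, hw, rfl⟩ := hv
    exact hw.1

theorem mem_maxOrientation {n : ℕ} (c : {v // v ∈ V} → Fin n) (e : {e // e ∈ h.edges})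
    (v : {v // v ∈ V}) : (v : α) ∈ (maxOrientation h c).toFun e ↔ IsMaxVertex c e.1 v := by
  simp [maxOrientation]

/-- Strict colorings are thus the fibres of `maxOrientation`, which allows grouping colorings by
orientation. -/
theorem mem_strictColorings_iff {n : ℕ} (f : Orientation h) (c : {v // v ∈ V} → Fin n) :
    c ∈ strictColorings h f n ↔ f = maxOrientation h c := by
  constructor
  · intro hc
    refine Orientation.ext (funext fun e => Finset.ext fun v => ?_)
    constructor
    · intro hv
      have hvV := h.subset_of_mem _ e.2 (f.subset e hv)
      exact (mem_maxOrientation c e ⟨v, hvV⟩).2 ((hc e ⟨v, hvV⟩).1 hv)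
    · intro hv
      have hvV := h.subset_of_mem _ e.2 ((maxOrientation h c).subset e hv)
      exact (hc e ⟨v, hvV⟩).2 ((mem_maxOrientation c e ⟨v, hvV⟩).1 hv)
  · rintro rfl e v
    exact mem_maxOrientation c e v

theorem lastParts_eq_image {n : ℕ} (D : Decomposition V n) :
    lastParts h D.1 = (maxOrientation h (decompositionEquiv V n D)).image := by
  have key : ∀ e : {e // e ∈ h.edges},
      lastPart n D.1 e.1 = (maxOrientation h (decompositionEquiv V n D)).toFun e := by
    intro e
    ext v
    by_cases hvV : v ∈ V
    · rw [mem_maxOrientation _ e ⟨v, hvV⟩,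
        mem_lastPart D.2.1 ((h.subset_of_mem _ e.2).trans D.2.2.symm.subset)
          (mem_decompositionEquiv D ⟨v, hvV⟩)]
      refine and_congr_right fun _ => ⟨fun H w hw => H w hw _ (mem_decompositionEquiv D w),
        fun H w hw j hj => ?_⟩
      have hwV := h.subset_of_mem _ e.2 hw
      have : j = decompositionEquiv V n D ⟨w, hwV⟩ := by
        by_contra hne
        exact Finset.disjoint_left.1 (D.2.1 hne) hj (mem_decompositionEquiv D ⟨w, hwV⟩)
      exact this ▸ H ⟨w, hwV⟩ hw
    · refine iff_of_false (fun hv => hvV ?_) (fun hv => hvV ?_)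
      · exact h.subset_of_mem _ e.2 (lastPart_subset _ _ _ hv)
      · exact h.subset_of_mem _ e.2 ((maxOrientation h _).subset e hv)
  ext e
  simp only [lastParts, Orientation.image, Finset.mem_image, Finset.mem_univ, true_and]
  constructor
  · rintro ⟨e', he', rfl⟩
    exact ⟨⟨e', he'⟩, (key ⟨e', he'⟩).symm⟩
  · rintro ⟨e', rfl⟩
    exact ⟨e'.1, e'.2, key e'⟩

theorem chi_single_eq_sum (ζ : Character K α) (h : SimpleHypergraph V) (n : ℕ) :
    chi ζ (single K h) n =
      ∑ c : {v // v ∈ V} → Fin n, ζ.val (maxOrientation h c).image := by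
  rw [chi, ← (decompositionEquiv V n).sum_comp]
  refine Finset.sum_congr rfl fun D _ => ?_
  rw [mulIter_comulIter_single, lastParts_eq_image, Character.val]

end Invariant

/-- A walk of minimal length visits distinct points. -/
theorem exists_injective_of_reflTransGen {E : Type*} {R : E → E → Prop} {a b : E}
    (hab : Relation.ReflTransGen R a b) :
    ∃ (m : ℕ) (e : Fin (m + 1) → E), Function.Injective e ∧
      (∀ i : Fin m, R (e i.castSucc) (e i.succ)) ∧ e 0 = a ∧ e (Fin.last m) = b := by
  classical
  have hex : ∃ (m : ℕ) (s : ℕ → E), (∀ i < m, R (s i) (s (i + 1))) ∧ s 0 = a ∧ s m = b := by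
    induction hab with
    | refl => exact ⟨0, fun _ => a, by simp, rfl, rfl⟩
    | @tail b c _ hbc ih =>
      obtain ⟨m, s, hs, h0, hm⟩ := ih
      refine ⟨m + 1, fun i => if i ≤ m then s i else c, fun i hi => ?_, by simp [h0], by simp⟩
      rcases Nat.lt_succ_iff_lt_or_eq.1 hi with hi | rfl
      · have h1 : i ≤ m := hi.le
        have h2 : i + 1 ≤ m := hi
        simpa [h1, h2] using hs i hi
      · simpa [hm] using hbc
  obtain ⟨s, hs, h0, hm⟩ := Nat.find_spec hex
  set m := Nat.find hex with hmdef
  have hinj : ∀ i j, i < j → j ≤ m → s i ≠ s j := by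
    intro i j hij hj heq
    -- A repetition `s i = s j` lets the loop between `i` and `j` be cut out, which shortens the
    -- walk.
    refine Nat.find_min hex (m := m - (j - i)) (by omega)
      ⟨fun k => if k ≤ i then s k else s (k + (j - i)), fun k hk => ?_, by simp [h0], ?_⟩
    · dsimp only
      split_ifs with h1 h2 h2
      · exact hs k (by omega)
      · have hki : k = i := by omega
        subst hki
        rw [heq, show k + 1 + (j - k) = j + 1 by omega]
        exact hs j (by omega)
      · omega
      · rw [show k + 1 + (j - i) = k + (j - i) + 1 by omega]
        exact hs _ (by omega)
    · dsimp only
      split_ifs with h1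
      · have h2 : j = m := by omega
        rw [show m - (j - i) = i by omega, heq, h2, hm]
      · rw [show m - (j - i) + (j - i) = m by omega, hm]
  refine ⟨m, fun i => s i, fun i j hij => ?_, fun i => ?_, by simpa using h0, by simpa using hm⟩
  · rcases lt_trichotomy (i : ℕ) j with h | h | h
    · exact absurd hij (hinj _ _ h (Nat.lt_succ_iff.1 j.2))
    · exact Fin.ext h
    · exact absurd hij.symm (hinj _ _ h (Nat.lt_succ_iff.1 i.2))
  · simpa using hs i i.2

/-! ### Acyclic orientations and the digraph of components of `f(h)` -/

section Orientations

variable {α : Type*} [DecidableEq α] {V : Finset α} {h : SimpleHypergraph V}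

namespace Orientation

/-- The relation between consecutive edges in the definition of acyclicity. -/
def Step (f : Orientation h) (e e' : {e // e ∈ h.edges}) : Prop :=
  (f.toFun e ∩ f.source e').Nonempty ∨
    ((f.toFun e ∩ e'.1).Nonempty ∧ f.toFun e ∩ e'.1 ⊂ f.toFun e')

variable {f : Orientation h}

theorem IsAcyclic.not_nonempty (hf : f.IsAcyclic) {e e' : {e // e ∈ h.edges}}
    (he : Relation.ReflTransGen f.Step e e') : ¬ (f.toFun e' ∩ f.source e).Nonempty := by
  intro hne
  obtain ⟨m, s, hinj, hs, rfl, rfl⟩ := exists_injective_of_reflTransGen he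
  exact hf ⟨m, s, hinj, hs, hne⟩

theorem image_adj {v w : {v // v ∈ V}} : f.image.vertexGraph.Adj v w ↔
    v ≠ w ∧ ∃ e, (v : α) ∈ f.toFun e ∧ (w : α) ∈ f.toFun e := by
  simp [SimpleHypergraph.vertexGraph, image]

theorem connectedComponentMk_eq {e : {e // e ∈ h.edges}} {v w : {v // v ∈ V}}
    (hv : (v : α) ∈ f.toFun e) (hw : (w : α) ∈ f.toFun e) :
    f.image.vertexGraph.connectedComponentMk v = f.image.vertexGraph.connectedComponentMk w := by
  by_cases hvw : v = w
  · rw [hvw]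
  · exact SimpleGraph.ConnectedComponent.sound
      (SimpleGraph.Adj.reachable (image_adj.2 ⟨hvw, e, hv, hw⟩))

/-- Suppose the walk goes from `u ∈ f(e)` to `v ∉ f(e)` with both in `f(g)`. Then `f(e)` meets `g`,
and either meets `f_s(g)` or cuts `g` in a subset of `f(g)` that misses `v`. This is what the second
alternative in the definition of acyclicity is for. -/
theorem exists_steps_of_walk {v w : {v // v ∈ V}} (p : f.image.vertexGraph.Walk v w)
    {e : {e // e ∈ h.edges}} (hv : (v : α) ∈ f.toFun e) :
    ∃ g, Relation.ReflTransGen f.Step e g ∧ (w : α) ∈ f.toFun g := by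
  induction p generalizing e with
  | nil => exact ⟨e, .refl, hv⟩
  | @cons u v w hadj p ih =>
    obtain ⟨-, g, hu, hvg⟩ := image_adj.1 hadj
    by_cases hve : (v : α) ∈ f.toFun e
    · exact ih hve
    obtain ⟨g', hg, hw⟩ := ih hvg
    refine ⟨g', .head ?_ hg, hw⟩
    by_cases hs : (f.toFun e ∩ f.source g).Nonempty
    · exact Or.inl hs
    · refine Or.inr ⟨⟨u, Finset.mem_inter.2 ⟨hv, f.subset g hu⟩⟩, Finset.ssubset_iff_subset_ne.2
        ⟨fun x hx => ?_, fun heq => hve ?_⟩⟩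
      · rw [Finset.mem_inter] at hx
        by_contra hxg
        exact hs ⟨x, Finset.mem_inter.2 ⟨hx.1, Finset.mem_sdiff.2 ⟨hx.2, hxg⟩⟩⟩
      · rw [← heq] at hvg
        exact (Finset.mem_inter.1 hvg).1

/-- The components of `f(h)` of the sources of an edge have an arrow to that of its target. -/
def ComponentArrow (f : Orientation h) (A B : f.image.vertexGraph.ConnectedComponent) : Prop :=
  ∃ e, (∃ v : {v // v ∈ V}, (v : α) ∈ f.source e ∧ f.image.vertexGraph.connectedComponentMk v = A) ∧
    ∃ w : {v // v ∈ V}, (w : α) ∈ f.toFun e ∧ f.image.vertexGraph.connectedComponentMk w = B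

theorem exists_steps_of_reachable {v w : {v // v ∈ V}}
    (hvw : f.image.vertexGraph.connectedComponentMk v = f.image.vertexGraph.connectedComponentMk w)
    {e : {e // e ∈ h.edges}} (hv : (v : α) ∈ f.toFun e) :
    ∃ g, Relation.ReflTransGen f.Step e g ∧ (w : α) ∈ f.toFun g := by
  obtain ⟨p⟩ := SimpleGraph.ConnectedComponent.exact hvw
  exact exists_steps_of_walk p hv

/-- Where two arrows meet, steps inside the common component carry the target of the first edge to a
source vertex of the second. -/
theorem exists_steps_of_transGen {A B : f.image.vertexGraph.ConnectedComponent}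
    (hAB : Relation.TransGen f.ComponentArrow A B) :
    ∃ e e', Relation.ReflTransGen f.Step e e' ∧
      (∃ v : {v // v ∈ V}, (v : α) ∈ f.source e ∧
        f.image.vertexGraph.connectedComponentMk v = A) ∧
      ∃ w : {v // v ∈ V}, (w : α) ∈ f.toFun e' ∧
        f.image.vertexGraph.connectedComponentMk w = B := by
  induction hAB with
  | single hAB =>
    obtain ⟨e, hA, hB⟩ := hAB
    exact ⟨e, e, .refl, hA, hB⟩
  | tail _ hBC ih =>
    obtain ⟨e, e', hee', hA, w, hw, hwB⟩ := ih
    obtain ⟨e'', ⟨v, hv, hvB⟩, hC⟩ := hBC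
    obtain ⟨g, hg, hvg⟩ := exists_steps_of_reachable (hwB.trans hvB.symm) hw
    exact ⟨e, e'', (hee'.trans hg).tail (Or.inl ⟨v, Finset.mem_inter.2 ⟨hvg, hv⟩⟩), hA, hC⟩

/-- A cycle of components lifts to a chain of steps from an edge `e` to one whose target meets
`f_s(e)`, against acyclicity. Finiteness does the rest. -/
theorem IsAcyclic.wellFounded (hf : f.IsAcyclic) :
    WellFounded fun A B => f.ComponentArrow B A := by
  have hirr : ∀ A, ¬ Relation.TransGen (fun A B => f.ComponentArrow B A) A A := by
    intro A hA
    obtain ⟨e, e', hee', ⟨v, hv, hvA⟩, w, hw, hwA⟩ :=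
      exists_steps_of_transGen (Relation.transGen_swap.1 hA)
    obtain ⟨g, hg, hvg⟩ := exists_steps_of_reachable (hwA.trans hvA.symm) hw
    exact hf.not_nonempty (hee'.trans hg) ⟨v, Finset.mem_inter.2 ⟨hvg, hv⟩⟩
  have : Std.Irrefl (Relation.TransGen fun A B => f.ComponentArrow B A) := ⟨hirr⟩
  have hwf := Finite.wellFounded_of_trans_of_irrefl
    (Relation.TransGen fun A B => f.ComponentArrow B A)
  exact hwf.mono fun _ _ hab => Relation.TransGen.single hab

end Orientation

/-! ### Colorings compatible with an orientation -/

variable {n : ℕ}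

theorem exists_mem_image (f : Orientation h) (e : {e // e ∈ h.edges}) :
    ∃ v : {v // v ∈ V}, (v : α) ∈ f.toFun e := by
  obtain ⟨v, hv⟩ := f.nonempty e
  exact ⟨⟨v, h.subset_of_mem _ e.2 (f.subset e hv)⟩, hv⟩

theorem mem_colorings_iff {f : Orientation h} {c : {v // v ∈ V} → Fin n} :
    c ∈ colorings h f n ↔
      (∀ e, ∀ v w : {v // v ∈ V}, (v : α) ∈ f.toFun e → (w : α) ∈ f.toFun e → c v = c w) ∧
      ∀ e, ∀ v w : {v // v ∈ V}, (v : α) ∈ f.source e → (w : α) ∈ f.toFun e →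
        (c v : ℕ) ≤ c w := by
  constructor
  · intro hc
    refine ⟨fun e v w hv hw => ?_, fun e v w hv hw => ?_⟩
    · exact le_antisymm ((hc e w hw).2 v (f.subset e hv)) ((hc e v hv).2 w (f.subset e hw))
    · exact (hc e w hw).2 v (Finset.mem_sdiff.1 hv).1
  · rintro ⟨h1, h2⟩ e v hv
    refine ⟨f.subset e hv, fun w hw => ?_⟩
    by_cases hwf : (w : α) ∈ f.toFun e
    · exact (h1 e w v hwf hv).le
    · exact h2 e w v (Finset.mem_sdiff.2 ⟨hw, hwf⟩) hv

theorem mem_strictColorings_iff_lt {f : Orientation h} {c : {v // v ∈ V} → Fin n} :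
    c ∈ strictColorings h f n ↔
      (∀ e, ∀ v w : {v // v ∈ V}, (v : α) ∈ f.toFun e → (w : α) ∈ f.toFun e → c v = c w) ∧
      ∀ e, ∀ v w : {v // v ∈ V}, (v : α) ∈ f.source e → (w : α) ∈ f.toFun e →
        (c v : ℕ) < c w := by
  constructor
  · intro hc
    refine ⟨(mem_colorings_iff.1 fun e v hv => (hc e v).1 hv).1, fun e v w hv hw => ?_⟩
    rw [Orientation.source, Finset.mem_sdiff] at hv
    have hmax := ((hc e w).1 hw).2
    refine lt_of_not_ge fun hle => hv.2 ((hc e v).2 ⟨hv.1, fun u hu => (hmax u hu).trans hle⟩)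
  · rintro ⟨h1, h2⟩ e v
    refine ⟨fun hv => (mem_colorings_iff.2 ⟨h1, fun e v w hv hw => (h2 e v w hv hw).le⟩) e v hv,
      fun hv => ?_⟩
    by_contra hvf
    obtain ⟨w, hw⟩ := exists_mem_image f e
    exact absurd (hv.2 w (f.subset e hw)) (not_le.2 (h2 e v w (Finset.mem_sdiff.2 ⟨hv.1, hvf⟩) hw))

-- A coloring constant on every `f(e)` is constant along walks, so it factors through the components
-- of `f(h)`; the source-to-target conditions become conditions on arrows. The relation `s` stands
-- for both `<` and `≤`.
open Classical in
theorem ncard_eq_card_arrowMaps (f : Orientation h)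
    [Fintype f.image.vertexGraph.ConnectedComponent]
    {s : ℕ → ℕ → Prop} {T : Set ({v // v ∈ V} → Fin n)}
    (hT : ∀ c, c ∈ T ↔
      (∀ e, ∀ v w : {v // v ∈ V}, (v : α) ∈ f.toFun e → (w : α) ∈ f.toFun e → c v = c w) ∧
      ∀ e, ∀ v w : {v // v ∈ V}, (v : α) ∈ f.source e → (w : α) ∈ f.toFun e →
        s (c v) (c w)) :
    T.ncard = (arrowMaps f.ComponentArrow s n Finset.univ).card := by
  rw [← Set.ncard_coe_finset]
  symm
  refine Set.ncard_congr
    (fun g hg v => ⟨g (f.image.vertexGraph.connectedComponentMk v),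
      (mem_arrowMaps.1 hg).1 _ (Finset.mem_univ _)⟩) ?_ ?_ ?_
  · intro g hg
    rw [hT]
    refine ⟨fun e v w hv hw => ?_, fun e v w hv hw => ?_⟩
    · simp only [Orientation.connectedComponentMk_eq hv hw]
    · exact (mem_arrowMaps.1 hg).2.2 _ (Finset.mem_univ _) _ (Finset.mem_univ _)
        ⟨e, ⟨v, hv, rfl⟩, w, hw, rfl⟩
  · intro g g' hg hg' heq
    funext A
    induction A using SimpleGraph.ConnectedComponent.ind with
    | h v => exact congrArg Fin.val (congrFun heq v)
  · intro c hc
    rw [hT] at hc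
    have hconst : ∀ v w (p : f.image.vertexGraph.Walk v w), c v = c w := by
      intro v w p
      induction p with
      | nil => rfl
      | cons hadj p ih =>
        obtain ⟨-, e, hv, hw⟩ := Orientation.image_adj.1 hadj
        exact (hc.1 e _ _ hv hw).trans ih
    refine ⟨SimpleGraph.ConnectedComponent.lift (fun v => (c v : ℕ))
      fun v w p _ => congrArg Fin.val (hconst v w p), ?_, ?_⟩
    · rw [Finset.mem_coe, mem_arrowMaps]
      refine ⟨fun A _ => ?_, fun A hA => absurd (Finset.mem_univ A) hA, ?_⟩
      · induction A using SimpleGraph.ConnectedComponent.ind with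
        | h v => exact (c v).2
      · rintro _ - _ - ⟨e, ⟨v, hv, rfl⟩, w, hw, rfl⟩
        exact hc.2 e v w hv hw
    · rfl

/-- The maximal color of an edge never drops along a step and strictly rises when `f(e)` meets
`f_s(e')`; the closing condition of a cycle is such a rise. -/
theorem maxOrientation_isAcyclic (c : {v // v ∈ V} → Fin n) : (maxOrientation h c).IsAcyclic := by
  set f := maxOrientation h c with hf
  have hmax : ∀ (e : {e // e ∈ h.edges}) (v : {v // v ∈ V}),
      (v : α) ∈ f.toFun e ↔ IsMaxVertex c e.1 v := fun e v => mem_maxOrientation c e v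
  have mem_V : ∀ {e : {e // e ∈ h.edges}} {x : α}, x ∈ f.toFun e → x ∈ V := fun {e x} hx =>
    h.subset_of_mem _ e.2 (f.subset e hx)
  have hlt : ∀ {e e' : {e // e ∈ h.edges}} {v w : {v // v ∈ V}},
      (f.toFun e ∩ f.source e').Nonempty → (v : α) ∈ f.toFun e → (w : α) ∈ f.toFun e' →
        c v < c w := by
    rintro e e' v w ⟨x, hx⟩ hv hw
    obtain ⟨hx, hx'⟩ := Finset.mem_inter.1 hx
    have h1 := ((mem_strictColorings_iff f c).2 hf)
    rw [mem_strictColorings_iff_lt] at h1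
    rw [h1.1 e v ⟨x, mem_V hx⟩ hv hx]
    exact h1.2 e' ⟨x, mem_V hx⟩ w hx' hw
  have hle : ∀ {e e' : {e // e ∈ h.edges}} {v w : {v // v ∈ V}},
      (f.toFun e ∩ e'.1).Nonempty → (v : α) ∈ f.toFun e → (w : α) ∈ f.toFun e' →
        c v ≤ c w := by
    rintro e e' v w ⟨x, hx⟩ hv hw
    obtain ⟨hx, hx'⟩ := Finset.mem_inter.1 hx
    exact (((hmax e ⟨x, mem_V hx⟩).1 hx).2 v (f.subset e hv)).trans
      (((hmax e' w).1 hw).2 ⟨x, mem_V hx⟩ hx')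
  rintro ⟨m, s, -, hs, hlast⟩
  have hmono : ∀ (i : Fin (m + 1)) (v w : {v // v ∈ V}), (v : α) ∈ f.toFun (s 0) →
      (w : α) ∈ f.toFun (s i) → c v ≤ c w := by
    intro i
    induction i using Fin.induction with
    | zero => exact fun v w hv hw => ((hmax _ w).1 hw).2 v (f.subset _ hv)
    | succ i ih =>
      intro v w hv hw
      obtain ⟨u, hu⟩ := exists_mem_image f (s i.castSucc)
      refine (ih v u hv hu).trans ?_
      rcases hs i with hi | hi
      · exact (hlt hi hu hw).le
      · exact hle hi.1 hu hw
  obtain ⟨v, hv⟩ := exists_mem_image f (s 0)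
  obtain ⟨w, hw⟩ := exists_mem_image f (s (Fin.last m))
  exact absurd (hmono _ v w hv hw) (not_le.2 (hlt hlast hw hv))

open Polynomial in
theorem exists_polynomial_strictColorings {f : Orientation h} (hf : f.IsAcyclic) :
    ∃ p : ℚ[X], (∀ n : ℕ, p.eval (n : ℚ) = (strictColorings h f n).ncard) ∧
      ∀ n : ℕ, p.eval (-(n : ℚ)) = (-1) ^ f.image.cc * (colorings h f n).ncard := by
  classical
  have : Fintype f.image.vertexGraph.ConnectedComponent := Fintype.ofFinite _
  obtain ⟨p, h1, h2⟩ := exists_order_polynomial hf.wellFounded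
  refine ⟨p, fun n => ?_, fun n => ?_⟩
  · rw [h1, ncard_eq_card_arrowMaps f fun c => mem_strictColorings_iff_lt]
  · rw [h2, ncard_eq_card_arrowMaps f fun c => mem_colorings_iff, SimpleHypergraph.cc,
      Nat.card_eq_fintype_card]

theorem chi_single_eq_sum_acyclic {K : Type*} [Field K] (ζ : Character K α)
    (h : SimpleHypergraph V) (n : ℕ) :
    chi ζ (single K h) n =
      ∑ f ∈ acyclicOrientations h, ζ.val f.image * ((strictColorings h f n).ncard : K) := by
  classical
  rw [chi_single_eq_sum, ← Finset.sum_fiberwise_of_maps_to (t := acyclicOrientations h)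
    (g := maxOrientation h)]
  · refine Finset.sum_congr rfl fun f _ => ?_
    rw [Finset.sum_congr rfl fun c hc => by rw [(Finset.mem_filter.1 hc).2], Finset.sum_const,
      nsmul_eq_mul, mul_comm, ← Set.ncard_coe_finset]
    congr 3
    ext c
    simp [mem_strictColorings_iff, eq_comm]
  · intro c _
    simpa [acyclicOrientations] using maxOrientation_isAcyclic c

/-- `V` is the disjoint union of the components, all of odd size, so `|V|` and `cc` have the same
parity. -/
theorem SimpleHypergraph.neg_one_pow_cc {K : Type*} [Field K] {g : SimpleHypergraph V}
    (hg : ∀ C : g.vertexGraph.ConnectedComponent, ¬ Even C.supp.ncard) :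
    (-1 : K) ^ g.cc = (-1) ^ V.card := by
  classical
  have : Fintype g.vertexGraph.ConnectedComponent := Fintype.ofFinite _
  have hV : V.card = ∑ C : g.vertexGraph.ConnectedComponent, C.supp.ncard := by
    rw [← Fintype.card_coe, ← Finset.card_univ,
      Finset.card_eq_sum_card_fiberwise (f := g.vertexGraph.connectedComponentMk)
        (t := Finset.univ) (by simp)]
    refine Finset.sum_congr rfl fun C _ => ?_
    rw [← Set.ncard_coe_finset]
    congr 1
    ext v
    simp
  rw [hV, ← Finset.prod_pow_eq_pow_sum,
    Finset.prod_congr rfl fun C _ => (Nat.not_even_iff_odd.1 (hg C)).neg_one_pow,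
    Finset.prod_const, Finset.card_univ, cc, Nat.card_eq_fintype_card]

open Classical in
theorem natCast_ncard_eq_sum {K β : Type*} [Field K] [Fintype β] (S : Set β) :
    (S.ncard : K) = ∑ x, if x ∈ S then 1 else 0 := by
  rw [Set.ncard_eq_toFinset_card']
  simp

/-- For a characteristic function, `ζ(f(h))` is the indicator of `f` being a `ζ`-orientation. -/
theorem ncard_acyclicZetaOrientations_pairs {K : Type*} [Field K] (ζ : Character K α)
    (hζ : ζ.IsCharacteristic) {n : ℕ} (T : Orientation h → Set ({v // v ∈ V} → Fin n)) :
    (({fc : Orientation h × ({v // v ∈ V} → Fin n) |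
      fc.1 ∈ acyclicZetaOrientations ζ h ∧ fc.2 ∈ T fc.1}.ncard : ℕ) : K) =
      ∑ f ∈ acyclicOrientations h, ζ.val f.image * ((T f).ncard : K) := by
  classical
  rw [natCast_ncard_eq_sum, Fintype.sum_prod_type, acyclicOrientations, Finset.sum_filter]
  refine Finset.sum_congr rfl fun f _ => ?_
  rw [natCast_ncard_eq_sum]
  by_cases hf : f.IsAcyclic <;> rcases hζ V f.image with h0 | h0 <;>
    simp [acyclicZetaOrientations, hf, h0]

end Orientations

end HopfSHG

/-! ### The proposition -/

open HopfSHG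
theorem mainTheorem7 {K : Type*} [Field K] [CharZero K] {α : Type*} [DecidableEq α]
    (ζ : Character K α) (V : Finset α) (h : SimpleHypergraph V) :
    -- `p` is the polynomial, necessarily unique, with `p(n) = χ(n)` for all natural numbers `n`
    ∃ p : Polynomial K, (∀ n : ℕ, p.eval (n : K) = chi ζ (single K h) n) ∧
      (∀ n : ℕ, chi ζ (single K h) n =
        ∑ f ∈ acyclicOrientations h, ζ.val f.image * ((strictColorings h f n).ncard : K)) ∧
      (∀ n : ℕ, p.eval (-(n : K)) =
        ∑ f ∈ acyclicOrientations h,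
          (-1) ^ f.image.cc * ζ.val f.image * ((colorings h f n).ncard : K)) ∧
      (ζ.IsCharacteristic →
        (∀ n : ℕ, chi ζ (single K h) n =
          (({fc : Orientation h × ({v // v ∈ V} → Fin n) |
            fc.1 ∈ acyclicZetaOrientations ζ h ∧ fc.2 ∈ strictColorings h fc.1 n}.ncard : ℕ) : K)) ∧
        (ζ.IsOdd →
          (∀ n : ℕ, (-1) ^ V.card * p.eval (-(n : K)) =
            (({fc : Orientation h × ({v // v ∈ V} → Fin n) |
              fc.1 ∈ acyclicZetaOrientations ζ h ∧ fc.2 ∈ colorings h fc.1 n}.ncard : ℕ) : K)) ∧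
          (-1) ^ V.card * p.eval (-1) = ((acyclicZetaOrientations ζ h).ncard : K))) := by
  choose! q hq using fun (f : Orientation h) (hf : f.IsAcyclic) =>
    exists_polynomial_strictColorings hf
  have hA : ∀ f ∈ acyclicOrientations h, f.IsAcyclic := fun f hf => by
    simpa [acyclicOrientations] using hf
  have heval : ∀ (f : Orientation h) (x : ℚ),
      ((q f).map (algebraMap ℚ K)).eval (x : K) = (((q f).eval x : ℚ) : K) := fun f x => by
    rw [← eq_ratCast (algebraMap ℚ K) x, Polynomial.eval_map_apply, eq_ratCast]
  -- The polynomial is the `ζ`-weighted sum of the rational order polynomials, transported to `K`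
  -- along `ℚ → K`.
  have hneg : ∀ n : ℕ, (∑ f ∈ acyclicOrientations h,
      Polynomial.C (ζ.val f.image) * (q f).map (algebraMap ℚ K)).eval (-(n : K)) =
        ∑ f ∈ acyclicOrientations h,
          (-1) ^ f.image.cc * ζ.val f.image * ((colorings h f n).ncard : K) := by
    intro n
    rw [Polynomial.eval_finsetSum]
    refine Finset.sum_congr rfl fun f hf => ?_
    have := heval f (-(n : ℚ))
    push_cast at this
    rw [Polynomial.eval_mul, Polynomial.eval_C, this, (hq f (hA f hf)).2]
    push_cast
    ring
  refine ⟨_, fun n => ?_, chi_single_eq_sum_acyclic ζ h, hneg,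
    fun hζ => ⟨fun n => ?_, fun hodd => ?_⟩⟩
  · rw [chi_single_eq_sum_acyclic, Polynomial.eval_finsetSum]
    refine Finset.sum_congr rfl fun f hf => ?_
    have := heval f (n : ℚ)
    push_cast at this
    rw [Polynomial.eval_mul, Polynomial.eval_C, this, (hq f (hA f hf)).1]
    push_cast
    rfl
  · rw [chi_single_eq_sum_acyclic,
      ncard_acyclicZetaOrientations_pairs ζ hζ fun f => strictColorings h f n]
  · have hpairs : ∀ n : ℕ, (-1) ^ V.card * (∑ f ∈ acyclicOrientations h,
        Polynomial.C (ζ.val f.image) * (q f).map (algebraMap ℚ K)).eval (-(n : K)) =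
          (({fc : Orientation h × ({v // v ∈ V} → Fin n) |
            fc.1 ∈ acyclicZetaOrientations ζ h ∧ fc.2 ∈ colorings h fc.1 n}.ncard : ℕ) : K) :=
        fun n => by
      rw [hneg n, ncard_acyclicZetaOrientations_pairs ζ hζ fun f => colorings h f n,
        Finset.mul_sum]
      refine Finset.sum_congr rfl fun f _ => ?_
      -- If `ζ(f(h)) ≠ 0`, oddness excludes even components, and the two equal signs cancel.
      by_cases h0 : ζ.val f.image = 0
      · simp [h0]
      · rw [SimpleHypergraph.neg_one_pow_cc fun C hC => h0 (hodd V f.image ⟨C, hC⟩), ← mul_assoc,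
          ← mul_assoc, ← pow_add, ← two_mul, pow_mul]
        simp
    refine ⟨hpairs, ?_⟩
    have h1 := hpairs 1
    rw [Nat.cast_one] at h1
    rw [h1]
    congr 1
    -- With one color there is a single coloring, and it is compatible with every orientation.
    refine Set.ncard_congr (fun fc _ => fc.1) (fun fc hfc => hfc.1)
      (fun fc fc' _ _ hff => Prod.ext hff (Subsingleton.elim _ _)) fun f hf => ?_
    exact ⟨(f, fun _ => 0), ⟨hf, fun e v hv => ⟨f.subset e hv, fun _ _ => le_rfl⟩⟩, rfl⟩
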